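/- All spaces are finite-dimensional complex Hilbert spaces. In an $r$-round interaction, Bob first prepares a message in $\mathcal X_1$ together with a private memory $\mathcal W_0$; in round $i=1,\dots,r$ Alice applies a linear isometry $\mathcal X_i\otimes\mathcal Z_{i-1}\to\mathcal Y_i\otimes\mathcal Z_i$ (her pure strategy) and Bob a linear isometry $\mathcal Y_i\otimes\mathcal W_{i-1}\to\mathcal X_{i+1}\otimes\mathcal W_i$ (his pure co-strategy), where $\mathcal X_{r+1}=\mathbb C$; the result is a joint state of the final memories in $\mathcal Z_r\otimes\mathcal W_r$. An *interactive quantum bit-commitment protocol* consists of the following. In the commit phase, an $r$-round interaction, honest Alice uses a pure strategy $\tilde A^a$ if her uniformly random bit is $a\in\{0,1\}$. In the reveal phase she announces $a$, and the parties carry out a further interaction (which may depend on $a$), starting from their memories, in which she uses a prescribed pure strategy $\tilde R^a$. Finally Bob makes a two-outcome measurement (accept/abort) of his memory. The actions of honest Bob (his co-strategies in both phases, the one in the reveal phase depending on the announced bit, and his measurements) are not necessarily specified: the protocol gives a nonempty set $\mathcal B$ of behaviours that he may follow (a single one, or all that never abort with honest Alice, or anything in between), and for each behaviour in $\mathcal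 B$ he accepts honest Alice with probability $1$. - $\mathrm B_{\mathrm{BC}}$ is the supremum, over all pure co-strategies of a dishonest Bob in the commit phase and all two-outcome measurements of his memory after it, of the probability that he correctly guesses the uniformly random bit $a$ of honest Alice. - For $a\in\{0,1\}$, $\mathrm A_{\mathrm{BC}}(a)$ is Alice's cheating probability for changing her commitment from $a$ to $1-a$: she follows $\tilde A^a$ in the commit phase, then announces $1-a$ and uses any pure strategy in the interaction of the reveal phase, chosen without knowledge of Bob's actions. $\mathrm A_{\mathrm{BC}}(a)$ is the supremum over these strategies of the infimum over Bob's behaviours in $\mathcal B$ of the probability that Bob accepts $1-a$. **Theorem.** In any interactive quantum bit-commitment protocol, for each $a\in\{0,1\}$, $\mathrm A_{\mathrm{BC}}=\mathrm A_{\mathrm{BC}}(a)$ satisfies $$\sqrt{\mathrm A_{\mathrm{BC}}}+2\,\mathrm B_{\mathrm{BC}}\ \ge\ 2 ,$$ and hence $$\max\{\mathrm A_{\mathrm{BC}},\mathrm B_{\mathrm{BC}}\}\ \ge\ \frac{9-\sqrt{17}}{8}\approx 0.61 .$$ -/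

import Mathlib

open scoped Matrix ComplexOrder

noncomputable section

namespace QBC

/-- `A` is a linear isometry `ℂ^n → ℂ^m`. -/
def IsIsometry {m n : Type} [Fintype m] [Fintype n] (A : Matrix m n ℂ) : Prop :=
  letI := Classical.decEq n
  Aᴴ * A = 1

/-- `E` is one of the two operators of a two-outcome quantum measurement `{E, 1 - E}` on `ℂ^n`,
that is, `0 ≤ E ≤ 1`. -/
def IsEffect {n : Type} [Fintype n] (E : Matrix n n ℂ) : Prop :=
  letI := Classical.decEq n
  E.PosSemidef ∧ (1 - E).PosSemidef

/-- The message spaces of an interaction with `rounds` rounds. In round `i < rounds` Alice receives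
a message in `ℂ^(X i)` from Bob and answers with a message in `ℂ^(Y i)`. The last message is
Alice's answer in the last round: the "message" `X rounds` that would follow it is trivial
(its space is `ℂ`). The values of `X` beyond `rounds`, and of `Y` from `rounds` on, play no role. -/
structure Messages where
  rounds : ℕ
  X : ℕ → Type
  Y : ℕ → Type
  [finX : ∀ i, Fintype (X i)]
  [finY : ∀ i, Fintype (Y i)]
  [lastTrivial : Unique (X rounds)]

attribute [instance] Messages.finX Messages.finY Messages.lastTrivial

/-- A pure strategy of Alice for the message spaces `M`, started with a private memory `ℂ^Zin`.
`Z i` is the basis of her memory after `i` rounds. She first maps her memory to `ℂ^(Z 0)`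
by an isometry, and in round `i` applies an isometry
`ℂ^(X i) ⊗ ℂ^(Z i) → ℂ^(Y i) ⊗ ℂ^(Z (i+1))`. -/
structure PureStrategy (M : Messages) (Zin : Type) [Fintype Zin] where
  Z : ℕ → Type
  [finZ : ∀ i, Fintype (Z i)]
  init : Matrix (Z 0) Zin ℂ
  U : ∀ i, Matrix (M.Y i × Z (i + 1)) (M.X i × Z i) ℂ
  isometry_init : IsIsometry init
  isometry_U : ∀ i < M.rounds, IsIsometry (U i)

attribute [instance] PureStrategy.finZ

/-- A pure co-strategy of Bob for the message spaces `M`, started with a private memory `ℂ^Win`.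
He first prepares the first message and his memory `ℂ^(W 0)` from his initial memory by an isometry
`ℂ^Win → ℂ^(X 0) ⊗ ℂ^(W 0)` (for `Win = Unit` this is just a unit vector of the latter space),
and in round `i` applies an isometry `ℂ^(Y i) ⊗ ℂ^(W i) → ℂ^(X (i+1)) ⊗ ℂ^(W (i+1))`. -/
structure PureCoStrategy (M : Messages) (Win : Type) [Fintype Win] where
  W : ℕ → Type
  [finW : ∀ i, Fintype (W i)]
  prep : Matrix (M.X 0 × W 0) Win ℂ
  V : ∀ i, Matrix (M.X (i + 1) × W (i + 1)) (M.Y i × W i) ℂ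
  isometry_prep : IsIsometry prep
  isometry_V : ∀ i < M.rounds, IsIsometry (V i)

attribute [instance] PureCoStrategy.finW

/-- The basis of Alice's final memory space. -/
abbrev PureStrategy.Final {M : Messages} {Zin : Type} [Fintype Zin]
    (S : PureStrategy M Zin) : Type := S.Z M.rounds

/-- The basis of Bob's final memory space. -/
abbrev PureCoStrategy.Final {M : Messages} {Win : Type} [Fintype Win]
    (T : PureCoStrategy M Win) : Type := T.W M.rounds

section Interaction

variable {M : Messages} {Zin Win : Type} [Fintype Zin] [Fintype Win]

/-- The joint state (message from Bob, Alice's memory, Bob's memory) after `i` rounds of the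
interaction of `S` with `T`, when the two memories are initially in the joint state `ψ`. -/
def stateAfter (S : PureStrategy M Zin) (T : PureCoStrategy M Win) (ψ : Zin × Win → ℂ) :
    (i : ℕ) → M.X i × S.Z i × T.W i → ℂ
  | 0 => fun p => ∑ z₀, ∑ w₀, S.init p.2.1 z₀ * T.prep (p.1, p.2.2) w₀ * ψ (z₀, w₀)
  | i + 1 => fun p => ∑ y, ∑ w, T.V i (p.1, p.2.2) (y, w) *
      ∑ x, ∑ z, S.U i (y, p.2.1) (x, z) * stateAfter S T ψ i (x, z, w)

/-- The final joint state of the two memories. -/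
def finalState (S : PureStrategy M Zin) (T : PureCoStrategy M Win) (ψ : Zin × Win → ℂ) :
    S.Final × T.Final → ℂ :=
  fun p => stateAfter S T ψ M.rounds (default, p.1, p.2)

end Interaction

/-- The probability `⟨φ, (1 ⊗ E) φ⟩` of the outcome `E` when Bob measures his part of the joint
state `φ` of the two memories. -/
def outcomeProb {Z W : Type} [Fintype Z] [Fintype W] (E : Matrix W W ℂ) (φ : Z × W → ℂ) : ℝ :=
  (∑ z, ∑ w, ∑ w', star (φ (z, w)) * E w w' * φ (z, w')).re

/-- Honest Alice in a bit-commitment protocol. `commit` is the interaction of the commit phase, in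
which she uses the pure strategy `A a` to commit to the bit `a` (she has no memory at first).
In the reveal phase she announces `a`, after which the parties carry out the interaction `reveal a`,
in which she uses the pure strategy `R a` on the memory left from the commit phase. -/
structure HonestAlice where
  commit : Messages
  A : Bool → PureStrategy commit Unit
  reveal : Bool → Messages
  R : (a : Bool) → PureStrategy (reveal a) (A a).Final

/-- A possible behaviour of an honest Bob who faces such an Alice: the pure co-strategy `B` in the
commit phase; if the bit `b` is announced, the pure co-strategy `D b` in the interaction of the
reveal phase, and then the measurement `{E b, 1 - E b}`, in which `E b` means that he accepts. -/
structure Bob (H : HonestAlice) where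
  B : PureCoStrategy H.commit Unit
  D : (b : Bool) → PureCoStrategy (H.reveal b) B.Final
  E : (b : Bool) → Matrix (D b).Final (D b).Final ℂ
  isEffect : ∀ b, IsEffect (E b)

/-- The joint state of the memories after a commit phase in which Alice commits honestly to `a`. -/
def committedState (H : HonestAlice) (a : Bool) (B : PureCoStrategy H.commit Unit) :
    (H.A a).Final × B.Final → ℂ :=
  finalState (H.A a) B (fun _ => 1)

/-- The probability that the Bob `β` accepts the bit `b` if Alice has committed honestly to `a`, and
then announces `b` and uses the pure strategy `C` in the reveal phase. -/
def acceptProb {H : HonestAlice} (β : Bob H) (a b : Bool)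
    (C : PureStrategy (H.reveal b) (H.A a).Final) : ℝ :=
  outcomeProb (β.E b) (finalState C (β.D b) (committedState H a β.B))

/-- An interactive quantum bit-commitment protocol: it specifies the actions of honest Alice and
leaves to honest Bob a nonempty set `bobs` of possible behaviours (one element if his actions are
specified, possibly all behaviours that never abort with an honest Alice if they are not). Bob never
aborts if Alice is honest. -/
structure BitCommitment extends HonestAlice where
  bobs : Set (Bob toHonestAlice)
  nonempty : bobs.Nonempty
  complete : ∀ β ∈ bobs, ∀ a, acceptProb β a a (R a) = 1

/-- The cheating probability of Alice, for changing her commitment from `a` to `!a`: she has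
committed to `a`, announces `!a`, and chooses a pure strategy `C` for the reveal phase without
knowing which of the possible behaviours Bob follows. -/
def BitCommitment.aliceCheat (P : BitCommitment) (a : Bool) : ℝ :=
  ⨆ C : PureStrategy (P.reveal !a) (P.A a).Final, ⨅ β : P.bobs, acceptProb β.1 a (!a) C

/-- The cheating probability of Bob: he uses any pure co-strategy `T` in the commit phase with an
honest Alice, whose bit is uniformly random, and then guesses the bit by a measurement
`{E, 1 - E}` of his memory, in which `E` means that he guesses `0` (that is, `false`). -/
def BitCommitment.bobCheat (P : BitCommitment) : ℝ :=
  sSup {p : ℝ | ∃ (T : PureCoStrategy P.commit Unit) (E : Matrix T.Final T.Final ℂ),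
    letI := Classical.decEq T.Final
    IsEffect E ∧
      p = 1 / 2 * outcomeProb E (committedState P.toHonestAlice false T) +
        1 / 2 * outcomeProb (1 - E) (committedState P.toHonestAlice true T)}

end QBC

end

/-! Fix a and put c = 2 - 2 B_BC. For each commit co-strategy T of Bob let ψ_T and χ_T be the joint
states left by Alice's commitments to a and to 1 - a, and X_T = tr_Bob |ψ_T⟩⟨χ_T| (`crossTrace`). If
Bob distinguishes the two states badly, Uhlmann's theorem gives Alice a local contraction that makes
them overlap. Quantitatively, polar decomposition and Powers–Størmer give some V with ‖V‖ ≤ 1 and Re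
tr(V X_T) ≥ c (`exists_effect_contraction`, `exists_contraction_of_bobCheat`).

This V depends on T, which Alice does not know. The X_T form a convex set, because Bob can run two
co-strategies in superposition on orthogonal memories (`crossTrace_mix`). The contractions form a
compact convex set, so the minimax theorem `exists_forall_le_of_forall_exists_le` yields one V that
serves for every T.

Alice dilates this V to an isometry and then reveals 1 - a honestly. Later isometries preserve
overlaps, and Bob surely accepts the honest final state, so by Cauchy–Schwarz he accepts with
probability at least c² (`sq_le_outcomeProb`, `sq_le_aliceCheat`) when c ≥ 0. -/

namespace QBC

/-! ### Polar decomposition and the Powers–Størmer inequality -/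

section MatrixFacts

open scoped MatrixOrder Matrix.Norms.L2Operator

variable {m n l : Type} [Fintype m] [Fintype n] [Fintype l]

/-- The spectrum is finite. This opens the functional calculus to discontinuous functions, such as
the inverse square root and the step function below. -/
theorem continuousOn_spectrum [DecidableEq n] {A : Matrix n n ℂ} (f : ℝ → ℝ) :
    ContinuousOn f (spectrum ℝ A) :=
  A.finite_real_spectrum.continuousOn f

theorem trace_mul_re_nonneg {A B : Matrix n n ℂ} (hA : A.PosSemidef) (hB : B.PosSemidef) :
    0 ≤ (A * B).trace.re := by
  classical
  obtain ⟨C, rfl⟩ := CStarAlgebra.nonneg_iff_eq_star_mul_self.mp hA.nonneg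
  rw [Matrix.star_eq_conjTranspose, Matrix.mul_assoc, Matrix.trace_mul_comm]
  exact (Complex.le_def.mp (hB.mul_mul_conjTranspose_same C).trace_nonneg).1

/-- Polar decomposition, with a contraction in the place of the partial isometry. -/
theorem exists_contraction_polar [DecidableEq n] (A : Matrix m n ℂ) :
    ∃ U : Matrix m n ℂ, ‖U‖ ≤ 1 ∧ (Uᴴ * A).PosSemidef ∧ (Uᴴ * A) * (Uᴴ * A) = Aᴴ * A := by
  classical
  set ρ := Aᴴ * A with hρ
  have hpos : ρ.PosSemidef := Matrix.posSemidef_conjTranspose_mul_self A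
  have hsa : IsSelfAdjoint ρ := hpos.1
  -- Since `0⁻¹ = 0`, this is the pseudo-inverse of |A| = √ρ, so A f(ρ) is the polar partial
  -- isometry.
  set f : ℝ → ℝ := fun x => (√x)⁻¹
  have hP : (cfc f ρ)ᴴ = cfc f ρ := cfc_predicate (R := ℝ) (p := IsSelfAdjoint) f ρ
  have hspec : ∀ x ∈ spectrum ℝ ρ, 0 ≤ x := fun x hx => spectrum_nonneg_of_nonneg hpos.nonneg hx
  have hid : ρ = cfc (fun x : ℝ => x) ρ := (cfc_id' ℝ ρ).symm
  have hQ : (A * cfc f ρ)ᴴ * A = cfc (fun x => f x * x) ρ := by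
    rw [Matrix.conjTranspose_mul, hP, Matrix.mul_assoc, ← hρ,
      cfc_mul f (fun x => x) ρ (continuousOn_spectrum _) (continuousOn_spectrum _), ← hid]
  refine ⟨A * cfc f ρ, ?_, ?_, ?_⟩
  · have h1 : ‖(A * cfc f ρ)ᴴ * (A * cfc f ρ)‖ ≤ 1 := by
      rw [← Matrix.mul_assoc, hQ,
        ← cfc_mul _ f ρ (continuousOn_spectrum _) (continuousOn_spectrum _)]
      refine norm_cfc_le zero_le_one fun x hx => ?_
      have h0 := hspec x hx
      rcases h0.eq_or_lt with h | h
      · simp [← h]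
      · have : f x * x * f x = 1 := by
          have h2 : √x ≠ 0 := (Real.sqrt_pos.mpr h).ne'
          simp only [f]
          field_simp
          exact (Real.sq_sqrt h0).symm
        simp [this]
    rw [Matrix.l2_opNorm_conjTranspose_mul_self] at h1
    nlinarith [norm_nonneg (A * cfc f ρ)]
  · rw [hQ, ← Matrix.nonneg_iff_posSemidef]
    exact cfc_nonneg fun x hx => mul_nonneg (by positivity) (hspec x hx)
  · rw [hQ, ← cfc_mul _ _ ρ (continuousOn_spectrum _) (continuousOn_spectrum _)]
    conv_rhs => rw [hid]
    refine cfc_congr fun x hx => ?_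
    have h0 := hspec x hx
    rcases h0.eq_or_lt with h | h
    · simp [← h]
    · have h2 : √x ≠ 0 := (Real.sqrt_pos.mpr h).ne'
      have h3 := Real.sq_sqrt h0
      simp only [f]
      field_simp
      exact h3.symm

/-- The Powers–Størmer inequality, with the measurement that witnesses it. -/
theorem exists_effect_powers_stormer [DecidableEq n] {Q R : Matrix n n ℂ} (hQ : Q.PosSemidef)
    (hR : R.PosSemidef) :
    ∃ E : Matrix n n ℂ, E.PosSemidef ∧ (1 - E).PosSemidef ∧
      ((Q - R) * (Q - R)).trace.re + (Q * Q - R * R).trace.re ≤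
        2 * (E * (Q * Q - R * R)).trace.re := by
  set S := Q - R with hS
  have hsa : IsSelfAdjoint S := hQ.1.sub hR.1
  -- E is the spectral projection of Q - R onto its nonnegative part, so E S and E S - S are the
  -- positive and negative parts of S.
  set f : ℝ → ℝ := fun x => if 0 ≤ x then 1 else 0
  set E := cfc f S with hE
  have hid : S = cfc (fun x : ℝ => x) S := (cfc_id' ℝ S).symm
  have hES : E * S = cfc (fun x => f x * x) S := by
    rw [cfc_mul f (fun x => x) S (continuousOn_spectrum _) (continuousOn_spectrum _), ← hid]
  have hSE : S * E = E * S := by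
    rw [hES, show (fun x => f x * x) = fun x => x * f x from funext fun x => mul_comm _ _,
      cfc_mul (fun x => x) f S (continuousOn_spectrum _) (continuousOn_spectrum _), ← hid]
  have hplus : (E * S).PosSemidef := by
    rw [hES, ← Matrix.nonneg_iff_posSemidef]
    refine cfc_nonneg fun x _ => ?_
    simp only [f]
    split_ifs with h0 <;> simp [h0]
  have hminus : (E * S - S).PosSemidef := by
    have : E * S - S = cfc (fun x => f x * x - x) S := by
      rw [cfc_sub _ _ S (continuousOn_spectrum _) (continuousOn_spectrum _), hES, ← hid]
    rw [this, ← Matrix.nonneg_iff_posSemidef]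
    refine cfc_nonneg fun x _ => ?_
    simp only [f]
    split_ifs with h0
    · simp
    · linarith
  refine ⟨E, ?_, ?_, ?_⟩
  · rw [← Matrix.nonneg_iff_posSemidef]
    refine cfc_nonneg fun x _ => ?_
    simp only [f]
    split_ifs <;> simp
  · have : 1 - E = cfc (fun x => 1 - f x) S := by
      rw [cfc_sub _ _ S (continuousOn_spectrum _) (continuousOn_spectrum _), cfc_const_one ℝ S]
    rw [this, ← Matrix.nonneg_iff_posSemidef]
    refine cfc_nonneg fun x _ => ?_
    simp only [f]
    split_ifs <;> simp
  -- As E commutes with S, tr E(Q² - R²) = tr E S(Q + R), while tr S² + tr(Q² - R²) = 2 tr S Q. The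
  -- right side minus the left is therefore 2 tr(E S R) + 2 tr((E S - S) Q), a sum of two
  -- nonnegative terms.
  · have h1 := trace_mul_re_nonneg hplus hR
    have h2 := trace_mul_re_nonneg hminus hQ
    have e3 : (E * S * Q).trace = (E * (Q * Q)).trace - (E * (Q * R)).trace := by
      rw [← hSE, Matrix.mul_assoc, Matrix.trace_mul_comm, Matrix.mul_assoc, hS, Matrix.mul_sub,
        Matrix.mul_sub, Matrix.trace_sub]
    have e4 : (E * S * R).trace = (E * (R * Q)).trace - (E * (R * R)).trace := by
      rw [← hSE, Matrix.mul_assoc, Matrix.trace_mul_comm, Matrix.mul_assoc, hS, Matrix.mul_sub,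
        Matrix.mul_sub, Matrix.trace_sub]
    have e5 : (E * S * Q).trace = (E * (Q * Q)).trace - (E * (R * Q)).trace := by
      rw [hS]
      simp only [Matrix.mul_sub, Matrix.sub_mul, Matrix.trace_sub, Matrix.mul_assoc]
    have e6 : (R * Q).trace = (Q * R).trace := Matrix.trace_mul_comm _ _
    have e7 : ((E * S - S) * Q).trace = (E * S * Q).trace - ((Q * Q).trace - (R * Q).trace) := by
      rw [Matrix.sub_mul, Matrix.trace_sub, hS, Matrix.sub_mul Q R Q, Matrix.trace_sub]
    have e8 : (S * S).trace = (Q * Q).trace - (R * Q).trace - (Q * R).trace + (R * R).trace := by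
      rw [hS]
      simp only [Matrix.mul_sub, Matrix.sub_mul, Matrix.trace_sub]
      ring
    rw [e7] at h2
    rw [e8, Matrix.mul_sub, Matrix.trace_sub, Matrix.trace_sub]
    apply_fun Complex.re at e3 e4 e5 e6
    simp only [Complex.add_re, Complex.sub_re] at *
    linarith

/-- Two pure states `A`, `B` (with amplitudes as matrix entries) can be told apart by a measurement
of the second system, unless a contraction of the first system makes them overlap. -/
theorem exists_effect_contraction [DecidableEq n] [DecidableEq m] (A : Matrix m n ℂ)
    (B : Matrix l n ℂ) (hA : (Aᴴ * A).trace.re = 1) (hB : (Bᴴ * B).trace.re = 1) :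
    ∃ (E : Matrix n n ℂ) (V : Matrix l m ℂ), E.PosSemidef ∧ (1 - E).PosSemidef ∧ ‖V‖ ≤ 1 ∧
      2 - (V * (A * Bᴴ)).trace.re ≤
        (E * (Aᴴ * A)).trace.re + ((1 - E) * (Bᴴ * B)).trace.re := by
  obtain ⟨U, hU, hQ, hQQ⟩ := exists_contraction_polar A
  obtain ⟨T, hT, hR, hRR⟩ := exists_contraction_polar B
  obtain ⟨E, hE, hE', h⟩ := exists_effect_powers_stormer hQ hR
  refine ⟨E, T * Uᴴ, hE, hE', ?_, ?_⟩
  · refine (Matrix.l2_opNorm_mul _ _).trans ?_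
    rw [Matrix.l2_opNorm_conjTranspose]
    exact mul_le_one₀ hT (norm_nonneg _) hU
  -- With V = T Uᴴ the overlap becomes tr(|A| |B|), the cross term of tr(|A| - |B|)².
  · have e1 : (T * Uᴴ * (A * Bᴴ)).trace = (Uᴴ * A * (Tᴴ * B)).trace := by
      rw [← hR.1, Matrix.conjTranspose_mul, Matrix.conjTranspose_conjTranspose, Matrix.mul_assoc,
        Matrix.trace_mul_comm]
      simp only [Matrix.mul_assoc]
    have e2 : (Tᴴ * B * (Uᴴ * A)).trace = (Uᴴ * A * (Tᴴ * B)).trace := Matrix.trace_mul_comm _ _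
    rw [Matrix.sub_mul, Matrix.mul_sub, Matrix.mul_sub, Matrix.mul_sub, hQQ, hRR] at h
    rw [Matrix.sub_mul, Matrix.one_mul, e1]
    simp only [Matrix.trace_sub, Complex.sub_re, e2] at *
    linarith

theorem posSemidef_one_sub_of_norm_le_one [DecidableEq n] {V : Matrix m n ℂ} (hV : ‖V‖ ≤ 1) :
    (1 - Vᴴ * V).PosSemidef := by
  have h : ‖Vᴴ * V‖ ≤ 1 := by
    rw [Matrix.l2_opNorm_conjTranspose_mul_self]
    exact mul_le_one₀ hV (norm_nonneg _) hV
  exact (CStarAlgebra.norm_le_one_iff_of_nonneg _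
    (Matrix.posSemidef_conjTranspose_mul_self V).nonneg).mp h

end MatrixFacts

/-- A minimax theorem for a compact convex set and a convex set of linear functionals. -/
theorem exists_forall_le_of_forall_exists_le {E : Type*} [AddCommGroup E] [Module ℝ E]
    [TopologicalSpace E] [IsTopologicalAddGroup E] [ContinuousSMul ℝ E] [T2Space E]
    [FiniteDimensional ℝ E] {s : Set E} (hs : IsCompact s) (hconv : Convex ℝ s)
    {K : Set (E →ₗ[ℝ] ℝ)} (hK : Convex ℝ K) (hne : K.Nonempty) {c : ℝ}
    (h : ∀ k ∈ K, ∃ u ∈ s, c ≤ k u) : ∃ u ∈ s, ∀ k ∈ K, c ≤ k u := by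
  have hclosed : ∀ k : K, IsClosed {u | c ≤ k.1 u} := fun k =>
    isClosed_le continuous_const k.1.continuous_of_finiteDimensional
  suffices hfin : (s ∩ ⋂ k : K, {u | c ≤ k.1 u}).Nonempty by
    obtain ⟨u, hu, hu'⟩ := hfin
    exact ⟨u, hu, fun k hk => Set.mem_iInter.mp hu' ⟨k, hk⟩⟩
  -- By compactness it suffices to satisfy finitely many of the constraints at once.
  refine hs.inter_iInter_nonempty _ hclosed fun t => ?_
  rcases t.eq_empty_or_nonempty with rfl | ht
  · obtain ⟨k, hk⟩ := hne
    obtain ⟨u, hu, -⟩ := h k hk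
    exact ⟨u, by simpa using hu⟩
  by_contra hemp
  let L : E →ₗ[ℝ] (t → ℝ) := LinearMap.pi fun k => k.1.1
  have hLc : Continuous L := L.continuous_of_finiteDimensional
  -- If finitely many constraints fail jointly, the image of s misses the orthant [c, ∞)^t. The
  -- normal of a separating hyperplane then supplies weights for a convex combination in K that
  -- violates the hypothesis.
  have hdisj : Disjoint (L '' s) (Set.Ici fun _ => c) := by
    rw [Set.disjoint_left]
    rintro _ ⟨u, hu, rfl⟩ hcu
    refine hemp ⟨u, hu, ?_⟩
    simp only [Set.mem_iInter, Set.mem_ofPred_eq]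
    exact fun k hk => hcu ⟨k, hk⟩
  obtain ⟨f, a, b, hfa, hab, hfb⟩ := geometric_hahn_banach_compact_closed
    (hconv.linear_image L) (hs.image hLc) (convex_Ici _) isClosed_Ici hdisj
  classical
  set l : t → ℝ := fun k => f (Pi.single k 1) with hl
  have hf : ∀ x, f x = ∑ k, x k * l k := fun x => by
    conv_lhs => rw [pi_eq_sum_univ' x]
    simp [map_sum, hl]
  have hfb' : ∀ y : t → ℝ, (∀ k, c ≤ y k) → b < ∑ k, y k * l k := fun y hy => by
    rw [← hf]
    exact hfb y hy
  set σ := ∑ k, l k with hσ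
  have hbσ : b < c * σ := by
    have := hfb' (fun _ => c) fun _ => le_rfl
    rwa [← Finset.mul_sum] at this
  have hl0 : ∀ k, 0 ≤ l k := by
    intro k
    by_contra! hk
    -- With a negative weight at k, raising that coordinate by this amount stays in the orthant and
    -- brings the functional down to exactly b.
    have hr : 0 ≤ (c * σ - b) / -l k := div_nonneg (by linarith) (by linarith)
    have := hfb' (fun j => c + if j = k then (c * σ - b) / -l k else 0) fun j => by
      split_ifs <;> linarith
    simp only [add_mul, Finset.sum_add_distrib, ← Finset.mul_sum, ite_mul, zero_mul,
      Finset.sum_ite_eq', Finset.mem_univ, if_true] at this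
    rw [← hσ, div_neg, neg_mul, div_mul_cancel₀ _ hk.ne] at this
    linarith
  have hsum : 0 < σ := by
    refine (Finset.sum_nonneg fun k _ => hl0 k).lt_of_ne fun h0 => ?_
    have hz := (Finset.sum_eq_zero_iff_of_nonneg fun k _ => hl0 k).mp h0.symm
    obtain ⟨k, hk⟩ := hne
    obtain ⟨u, hu, -⟩ := h k hk
    have h1 := hfa _ ⟨u, hu, rfl⟩
    rw [hf, Finset.sum_eq_zero fun k hk => by rw [hz k hk, mul_zero]] at h1
    rw [hσ, ← h0, mul_zero] at hbσ
    linarith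
  have hmem : ∑ k, (l k / σ) • k.1.1 ∈ K := by
    refine hK.sum_mem (fun k _ => div_nonneg (hl0 k) hsum.le) ?_ fun k _ => k.1.2
    rw [← Finset.sum_div, div_self hsum.ne']
  obtain ⟨u, hu, hcu⟩ := h _ hmem
  have h1 := hfa _ ⟨u, hu, rfl⟩
  rw [hf] at h1
  have h2 : (∑ k, (l k / σ) • k.1.1 : E →ₗ[ℝ] ℝ) u = (∑ k, L u k * l k) / σ := by
    rw [LinearMap.sum_apply, Finset.sum_div]
    refine Finset.sum_congr rfl fun k _ => ?_
    simp [L]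
    ring
  rw [h2, le_div_iff₀ hsum] at hcu
  linarith

/-! ### Closure properties of isometries -/

section Isometries

variable {m n l k : Type} [Fintype m] [Fintype n] [Fintype l] [Fintype k]

theorem isIsometry_iff [DecidableEq n] {A : Matrix m n ℂ} : IsIsometry A ↔ Aᴴ * A = 1 := by
  unfold IsIsometry
  convert Iff.rfl

theorem IsIsometry.mul {A : Matrix m n ℂ} {B : Matrix n l ℂ} (hA : IsIsometry A)
    (hB : IsIsometry B) : IsIsometry (A * B) := by
  classical
  rw [isIsometry_iff] at *
  rw [Matrix.conjTranspose_mul, Matrix.mul_assoc, ← Matrix.mul_assoc Aᴴ, hA, Matrix.one_mul, hB]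

theorem IsIsometry.submatrix {m' n' : Type} [Fintype m'] [Fintype n'] {A : Matrix m n ℂ}
    (hA : IsIsometry A) (e : m' ≃ m) (f : n' ≃ n) : IsIsometry (A.submatrix e f) := by
  classical
  rw [isIsometry_iff] at *
  rw [Matrix.conjTranspose_submatrix, Matrix.submatrix_mul_equiv, hA, Matrix.submatrix_one_equiv]

open scoped Kronecker in
theorem IsIsometry.kronecker_one [DecidableEq k] {A : Matrix m n ℂ} (hA : IsIsometry A) :
    IsIsometry (A ⊗ₖ (1 : Matrix k k ℂ)) := by
  classical
  rw [isIsometry_iff] at *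
  rw [Matrix.conjTranspose_kronecker, ← Matrix.mul_kronecker_mul, hA, Matrix.conjTranspose_one,
    Matrix.one_mul, Matrix.one_kronecker_one]

theorem IsIsometry.fromBlocks {A : Matrix m n ℂ} {B : Matrix l k ℂ} (hA : IsIsometry A)
    (hB : IsIsometry B) : IsIsometry (Matrix.fromBlocks A 0 0 B) := by
  classical
  rw [isIsometry_iff] at *
  rw [Matrix.fromBlocks_conjTranspose, Matrix.fromBlocks_multiply, ← Matrix.fromBlocks_one]
  simp [hA, hB]

theorem IsIsometry.fromRows {A : Matrix m n ℂ} {B : Matrix l n ℂ} (hA : IsIsometry A)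
    (hB : IsIsometry B) {p q : ℝ} (hp : 0 ≤ p) (hq : 0 ≤ q) (hpq : p + q = 1) :
    IsIsometry (Matrix.fromRows ((√p : ℂ) • A) ((√q : ℂ) • B)) := by
  classical
  rw [isIsometry_iff] at *
  rw [Matrix.conjTranspose_fromRows_eq_fromCols_conjTranspose, Matrix.fromCols_mul_fromRows]
  simp only [Matrix.conjTranspose_smul, Matrix.smul_mul, Matrix.mul_smul, hA, hB, smul_smul,
    Complex.star_def, Complex.conj_ofReal, ← Complex.ofReal_mul, Real.mul_self_sqrt hp,
    Real.mul_self_sqrt hq, ← add_smul, ← Complex.ofReal_add, hpq]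
  simp

theorem IsIsometry.dotProduct {A : Matrix m n ℂ} (hA : IsIsometry A) (x y : n → ℂ) :
    star (A *ᵥ x) ⬝ᵥ (A *ᵥ y) = star x ⬝ᵥ y := by
  classical
  rw [isIsometry_iff] at hA
  rw [Matrix.star_mulVec, Matrix.dotProduct_mulVec, Matrix.vecMul_vecMul, hA, Matrix.vecMul_one]

end Isometries

/-! ### Interactions preserve inner products -/

section Interaction

variable {M : Messages} {Zin Win : Type} [Fintype Zin] [Fintype Win]

theorem dotProduct_prod₃ {α β γ : Type} [Fintype α] [Fintype β] [Fintype γ]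
    (f g : α × β × γ → ℂ) :
    star f ⬝ᵥ g = ∑ b, (star fun p : α × γ => f (p.1, b, p.2)) ⬝ᵥ fun p => g (p.1, b, p.2) := by
  simp only [dotProduct, Fintype.sum_prod_type]
  rw [Finset.sum_comm]
  rfl

theorem dotProduct_prod₃' {α β γ : Type} [Fintype α] [Fintype β] [Fintype γ]
    (f g : α × β × γ → ℂ) :
    star f ⬝ᵥ g = ∑ c, (star fun p : α × β => f (p.1, p.2, c)) ⬝ᵥ fun p => g (p.1, p.2, c) := by
  simp only [dotProduct, Fintype.sum_prod_type]
  simp_rw [Finset.sum_comm (γ := γ)]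
  rfl

/-- Bob's isometries act on the slices with Alice's memory fixed, and Alice's on the slices with
Bob's memory fixed. Cutting the inner product along each memory in turn removes them one by one. -/
theorem stateAfter_dotProduct (S : PureStrategy M Zin) (T : PureCoStrategy M Win)
    (ψ χ : Zin × Win → ℂ) {i : ℕ} (hi : i ≤ M.rounds) :
    star (stateAfter S T ψ i) ⬝ᵥ stateAfter S T χ i = star ψ ⬝ᵥ χ := by
  induction i with
  | zero =>
    have key : ∀ ψ : Zin × Win → ℂ, ∀ z, (fun p : M.X 0 × T.W 0 => stateAfter S T ψ 0 (p.1, z, p.2))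
        = T.prep *ᵥ fun w₀ => (S.init *ᵥ fun z₀ => ψ (z₀, w₀)) z := by
      intro ψ z
      ext p
      simp only [stateAfter, Matrix.mulVec, dotProduct, Finset.mul_sum]
      rw [Finset.sum_comm]
      exact Finset.sum_congr rfl fun _ _ => Finset.sum_congr rfl fun _ _ => by ring
    rw [dotProduct_prod₃]
    simp_rw [key, T.isometry_prep.dotProduct]
    simp only [dotProduct, Fintype.sum_prod_type_right]
    rw [Finset.sum_comm]
    exact Finset.sum_congr rfl fun w _ => S.isometry_init.dotProduct _ _
  | succ i ih =>
    have key : ∀ ψ : Zin × Win → ℂ, ∀ z,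
        (fun p : M.X (i + 1) × T.W (i + 1) => stateAfter S T ψ (i + 1) (p.1, z, p.2)) =
        T.V i *ᵥ fun q => (S.U i *ᵥ fun r => stateAfter S T ψ i (r.1, r.2, q.2)) (q.1, z) := by
      intro ψ z
      ext p
      simp only [stateAfter, Matrix.mulVec, dotProduct, Fintype.sum_prod_type]
    rw [← ih (by omega), dotProduct_prod₃, dotProduct_prod₃']
    simp_rw [key, (T.isometry_V i (by omega)).dotProduct]
    simp_rw [← (S.isometry_U i (by omega)).dotProduct]
    simp only [dotProduct, Fintype.sum_prod_type]
    rw [Finset.sum_comm]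
    conv_rhs => rw [Finset.sum_comm]
    refine Finset.sum_congr rfl fun y _ => ?_
    rw [Finset.sum_comm]
    rfl

theorem finalState_dotProduct (S : PureStrategy M Zin) (T : PureCoStrategy M Win)
    (ψ χ : Zin × Win → ℂ) : star (finalState S T ψ) ⬝ᵥ finalState S T χ = star ψ ⬝ᵥ χ := by
  rw [← stateAfter_dotProduct S T ψ χ le_rfl]
  simp only [dotProduct, finalState, Fintype.sum_prod_type, Fintype.sum_unique]
  rfl

end Interaction

/-! ### Outcome probabilities -/

section Measurement

variable {Z W : Type} [Fintype Z] [Fintype W]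

theorem isEffect_iff [DecidableEq W] {E : Matrix W W ℂ} :
    IsEffect E ↔ E.PosSemidef ∧ (1 - E).PosSemidef := by
  unfold IsEffect
  convert Iff.rfl

theorem outcomeProb_eq_sum (E : Matrix W W ℂ) (φ : Z × W → ℂ) :
    outcomeProb E φ = ∑ z, (star (fun w => φ (z, w)) ⬝ᵥ E *ᵥ fun w => φ (z, w)).re := by
  simp only [outcomeProb, Complex.re_sum, dotProduct, Matrix.mulVec, Finset.mul_sum, mul_assoc]
  rfl

/-- For the amplitude matrix A, AᴴA is the transpose of Bob's reduced state; hence the transpose on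
E. -/
theorem outcomeProb_eq_trace (E : Matrix W W ℂ) (φ : Z × W → ℂ) :
    outcomeProb E φ =
      (Eᵀ * ((Matrix.of fun z w => φ (z, w))ᴴ * Matrix.of fun z w => φ (z, w))).trace.re := by
  simp only [outcomeProb, Matrix.trace, Matrix.diag, Matrix.mul_apply, Matrix.transpose_apply,
    Matrix.conjTranspose_apply, Matrix.of_apply, Finset.mul_sum]
  congr 1
  rw [Finset.sum_comm]
  conv_rhs => rw [Finset.sum_comm]
  refine Finset.sum_congr rfl fun w _ => ?_
  rw [Finset.sum_comm]
  exact Finset.sum_congr rfl fun w' _ => Finset.sum_congr rfl fun z _ => by ring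

theorem outcomeProb_nonneg {E : Matrix W W ℂ} (hE : E.PosSemidef) (φ : Z × W → ℂ) :
    0 ≤ outcomeProb E φ := by
  rw [outcomeProb_eq_sum]
  exact Finset.sum_nonneg fun z _ => hE.re_dotProduct_nonneg _

theorem outcomeProb_one_sub [DecidableEq W] (E : Matrix W W ℂ) (φ : Z × W → ℂ) :
    outcomeProb (1 - E) φ = (star φ ⬝ᵥ φ).re - outcomeProb E φ := by
  rw [outcomeProb_eq_sum, outcomeProb_eq_sum, dotProduct, Fintype.sum_prod_type, Complex.re_sum,
    ← Finset.sum_sub_distrib]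
  refine Finset.sum_congr rfl fun z _ => ?_
  rw [Matrix.sub_mulVec, dotProduct_sub, Matrix.one_mulVec, Complex.sub_re]
  rfl

theorem outcomeProb_le [DecidableEq W] {E : Matrix W W ℂ} (hE : (1 - E).PosSemidef)
    (φ : Z × W → ℂ) : outcomeProb E φ ≤ (star φ ⬝ᵥ φ).re := by
  have := outcomeProb_nonneg hE φ
  rw [outcomeProb_one_sub] at this
  linarith

open scoped MatrixOrder in
/-- If `E` occurs with certainty in the state `φ`, then its probability in any state `χ` is at least
the squared overlap of the two states. -/
theorem sq_le_outcomeProb [DecidableEq W] {E : Matrix W W ℂ} (hE : E.PosSemidef)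
    (hE' : (1 - E).PosSemidef) {φ : Z × W → ℂ} (hφ : (star φ ⬝ᵥ φ).re = 1)
    (h : outcomeProb E φ = 1) (χ : Z × W → ℂ) :
    ‖star φ ⬝ᵥ χ‖ ^ 2 ≤ outcomeProb E χ := by
  have h0 : outcomeProb (1 - E) φ = 0 := by rw [outcomeProb_one_sub, hφ, h, sub_self]
  rw [outcomeProb_eq_sum] at h0
  replace h0 := (Finset.sum_eq_zero_iff_of_nonneg fun z _ => hE'.re_dotProduct_nonneg _).mp h0
  have hfix : ∀ z, E *ᵥ (fun w => φ (z, w)) = fun w => φ (z, w) := by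
    intro z
    have h1 : star (fun w => φ (z, w)) ⬝ᵥ (1 - E) *ᵥ (fun w => φ (z, w)) = 0 := by
      refine Complex.ext (h0 z (Finset.mem_univ z)) ?_
      exact (Complex.le_def.mp (hE'.dotProduct_mulVec_nonneg fun w => φ (z, w))).2.symm
    rw [hE'.dotProduct_mulVec_zero_iff, Matrix.sub_mulVec, Matrix.one_mulVec, sub_eq_zero] at h1
    exact h1.symm
  obtain ⟨C, hC⟩ := CStarAlgebra.nonneg_iff_eq_star_mul_self.mp hE.nonneg
  rw [Matrix.star_eq_conjTranspose] at hC
  -- With E = CᴴC, the map c = 1 ⊗ C turns the form ⟨ξ, (1 ⊗ E) η⟩ into an inner product. Since (1 ⊗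
  -- E) φ = φ, Cauchy–Schwarz for it bounds the overlap of φ with χ.
  let c : (Z × W → ℂ) → EuclideanSpace ℂ (Z × W) := fun ξ =>
    WithLp.toLp 2 fun p => (C *ᵥ fun w => ξ (p.1, w)) p.2
  have hin : ∀ ξ η : Z × W → ℂ, inner ℂ (c ξ) (c η) =
      ∑ z, star (fun w => ξ (z, w)) ⬝ᵥ E *ᵥ fun w => η (z, w) := by
    intro ξ η
    rw [EuclideanSpace.inner_eq_star_dotProduct, dotProduct_comm, dotProduct,
      Fintype.sum_prod_type]
    refine Finset.sum_congr rfl fun z _ => ?_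
    rw [hC, ← Matrix.mulVec_mulVec, Matrix.dotProduct_mulVec, ← Matrix.star_mulVec]
    rfl
  have hnorm : ∀ ξ : Z × W → ℂ, ‖c ξ‖ ^ 2 = outcomeProb E ξ := by
    intro ξ
    rw [@norm_sq_eq_re_inner ℂ, hin, outcomeProb_eq_sum, ← Complex.re_sum]
    rfl
  have hov : inner ℂ (c φ) (c χ) = star φ ⬝ᵥ χ := by
    rw [hin, dotProduct, Fintype.sum_prod_type]
    refine Finset.sum_congr rfl fun z _ => ?_
    rw [Matrix.dotProduct_mulVec]
    nth_rw 1 [← hE.1]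
    rw [← Matrix.star_mulVec, hfix]
    rfl
  have hcs := norm_inner_le_norm (𝕜 := ℂ) (c φ) (c χ)
  rw [hov] at hcs
  calc ‖star φ ⬝ᵥ χ‖ ^ 2 ≤ (‖c φ‖ * ‖c χ‖) ^ 2 := by gcongr
    _ = outcomeProb E χ := by rw [mul_pow, hnorm, hnorm, h, one_mul]

end Measurement

end QBC

noncomputable section

namespace QBC

/-! ### Convex mixtures of co-strategies -/

section Mixture

variable {M : Messages} {Zin Win : Type} [Fintype Zin] [Fintype Win]

/-- The mixture of two pure co-strategies: they run in superposition on orthogonal memories. -/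
def PureCoStrategy.mix (T T' : PureCoStrategy M Win) (p q : ℝ) (hp : 0 ≤ p) (hq : 0 ≤ q)
    (hpq : p + q = 1) : PureCoStrategy M Win where
  W i := T.W i ⊕ T'.W i
  prep := (Matrix.fromRows ((√p : ℂ) • T.prep) ((√q : ℂ) • T'.prep)).submatrix
    (Equiv.prodSumDistrib _ _ _) (Equiv.refl _)
  V i := (Matrix.fromBlocks (T.V i) 0 0 (T'.V i)).submatrix
    (Equiv.prodSumDistrib _ _ _) (Equiv.prodSumDistrib _ _ _)
  isometry_prep := (T.isometry_prep.fromRows T'.isometry_prep hp hq hpq).submatrix _ _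
  isometry_V i hi := ((T.isometry_V i hi).fromBlocks (T'.isometry_V i hi)).submatrix _ _

variable (S : PureStrategy M Zin) (T T' : PureCoStrategy M Win) {p q : ℝ} (hp : 0 ≤ p)
  (hq : 0 ≤ q) (hpq : p + q = 1) (ψ : Zin × Win → ℂ)

theorem stateAfter_mix (i : ℕ) :
    (∀ x z w, stateAfter S (T.mix T' p q hp hq hpq) ψ i (x, z, Sum.inl w) =
      √p * stateAfter S T ψ i (x, z, w)) ∧
    ∀ x z w, stateAfter S (T.mix T' p q hp hq hpq) ψ i (x, z, Sum.inr w) =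
      √q * stateAfter S T' ψ i (x, z, w) := by
  induction i with
  | zero =>
    constructor <;> intro x z w <;>
    · simp only [stateAfter, PureCoStrategy.mix, Matrix.submatrix_apply, Finset.mul_sum,
        Equiv.prodSumDistrib_apply_left, Equiv.prodSumDistrib_apply_right, Equiv.refl_apply,
        Matrix.fromRows_apply_inl, Matrix.fromRows_apply_inr, Matrix.smul_apply, smul_eq_mul]
      exact Finset.sum_congr rfl fun _ _ => Finset.sum_congr rfl fun _ _ => by ring
  | succ i ih =>
    obtain ⟨ih, ih'⟩ := ih
    have h₁₁ : ∀ x w y w', (T.mix T' p q hp hq hpq).V i (x, Sum.inl w) (y, Sum.inl w') =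
      T.V i (x, w) (y, w') := fun _ _ _ _ => rfl
    have h₁₂ : ∀ x w y w', (T.mix T' p q hp hq hpq).V i (x, Sum.inl w) (y, Sum.inr w') = 0 :=
      fun _ _ _ _ => rfl
    have h₂₁ : ∀ x w y w', (T.mix T' p q hp hq hpq).V i (x, Sum.inr w) (y, Sum.inl w') = 0 :=
      fun _ _ _ _ => rfl
    have h₂₂ : ∀ x w y w', (T.mix T' p q hp hq hpq).V i (x, Sum.inr w) (y, Sum.inr w') =
      T'.V i (x, w) (y, w') := fun _ _ _ _ => rfl
    constructor <;> intro x z w <;>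
    · rw [stateAfter, stateAfter, Finset.mul_sum]
      refine Finset.sum_congr rfl fun y _ => (Fintype.sum_sum_type _).trans ?_
      simp only [h₁₁, h₁₂, h₂₁, h₂₂, ih, ih', zero_mul, Finset.sum_const_zero, add_zero, zero_add,
        Finset.mul_sum]
      exact Finset.sum_congr rfl fun _ _ => Finset.sum_congr rfl fun _ _ =>
        Finset.sum_congr rfl fun _ _ => by ring

end Mixture

/-! ### Dilating a contraction to an isometry -/

section Dilation

open scoped Kronecker

variable {M : Messages} {Zin Win Z : Type} [Fintype Zin] [Fintype Win] [Fintype Z]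

/-- The pure strategy that first applies the isometry `J`, and then uses `S` with an idle register
`ℂ^G`. -/
def PureStrategy.afterIsometry (S : PureStrategy M Zin) (G : Type) [Fintype G] [DecidableEq G]
    (J : Matrix (Zin × G) Z ℂ) (hJ : IsIsometry J) : PureStrategy M Z where
  Z i := S.Z i × G
  init := (S.init ⊗ₖ (1 : Matrix G G ℂ)) * J
  U i := (S.U i ⊗ₖ (1 : Matrix G G ℂ)).submatrix
    (Equiv.prodAssoc _ _ _).symm (Equiv.prodAssoc _ _ _).symm
  isometry_init := S.isometry_init.kronecker_one.mul hJ
  isometry_U i hi := (S.isometry_U i hi).kronecker_one.submatrix _ _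

theorem stateAfter_afterIsometry (S : PureStrategy M Zin) {G : Type} [Fintype G] [DecidableEq G]
    (J : Matrix (Zin × G) Z ℂ) (hJ : IsIsometry J) (T : PureCoStrategy M Win) (ψ : Z × Win → ℂ)
    (i : ℕ) (x : M.X i) (z : S.Z i) (g : G) (w : T.W i) :
    stateAfter (S.afterIsometry G J hJ) T ψ i (x, (z, g), w) =
      stateAfter S T (fun p => ∑ z', J (p.1, g) z' * ψ (z', p.2)) i (x, z, w) := by
  induction i with
  | zero =>
    simp only [stateAfter, PureStrategy.afterIsometry, Matrix.mul_apply, Fintype.sum_prod_type,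
      Matrix.kronecker_apply, Matrix.one_apply, mul_ite, mul_one, mul_zero, ite_mul, zero_mul,
      Finset.sum_ite_eq, Finset.mem_univ, if_true, Finset.mul_sum, Finset.sum_mul]
    rw [Finset.sum_comm]
    conv_rhs => rw [Finset.sum_comm]
    refine Finset.sum_congr rfl fun _ _ => ?_
    rw [Finset.sum_comm]
    exact Finset.sum_congr rfl fun _ _ => Finset.sum_congr rfl fun _ _ => by ring
  | succ i ih =>
    have hU : ∀ y z x z' g', (S.afterIsometry G J hJ).U i (y, (z, g)) (x, (z', g')) =
      S.U i (y, z) (x, z') * (1 : Matrix G G ℂ) g g' := fun _ _ _ _ _ => rfl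
    rw [stateAfter, stateAfter]
    refine Finset.sum_congr rfl fun y _ => Finset.sum_congr rfl fun w _ => ?_
    congr 1
    refine Finset.sum_congr rfl fun x _ => (Fintype.sum_prod_type _).trans ?_
    refine Finset.sum_congr rfl fun z _ => ?_
    simp only [hU, ih, Matrix.one_apply, mul_ite, mul_one, mul_zero, ite_mul, zero_mul,
      Finset.sum_ite_eq, Finset.mem_univ, if_true]

open scoped Matrix.Norms.L2Operator in
/-- A contraction is a block of an isometry. -/
theorem exists_isometry_of_norm_le_one {m n : Type} [Fintype m] [Fintype n] [DecidableEq n]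
    [Nonempty m] {V : Matrix m n ℂ} (hV : ‖V‖ ≤ 1) :
    ∃ J : Matrix (m × Option n) n ℂ, IsIsometry J ∧ ∀ i j, J (i, none) j = V i j := by
  classical
  open scoped MatrixOrder in
  obtain ⟨N, hN⟩ := CStarAlgebra.nonneg_iff_eq_star_mul_self.mp
    (posSemidef_one_sub_of_norm_le_one hV).nonneg
  rw [Matrix.star_eq_conjTranspose] at hN
  obtain ⟨i₀⟩ := ‹Nonempty m›
  -- The flag `none` carries V. The other flags carry the defect N, with NᴴN = 1 - VᴴV, parked at
  -- the arbitrary basis vector i₀.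
  refine ⟨Matrix.of fun p j => p.2.elim (V p.1 j) fun k => if p.1 = i₀ then N k j else 0, ?_,
    fun i j => rfl⟩
  rw [isIsometry_iff, ← add_sub_cancel (Vᴴ * V) 1, hN]
  ext j k
  simp [Matrix.mul_apply, Fintype.sum_prod_type, Fintype.sum_option, Finset.sum_add_distrib]

end Dilation

/-! ### Cheating strategies and the tradeoff -/

section Protocol

variable {H : HonestAlice}

/-- The partial trace over Bob's memory of the operator `|ψ⟩⟨χ|`. -/
def crossTrace {Z Z' W : Type} [Fintype W] (ψ : Z × W → ℂ) (χ : Z' × W → ℂ) : Matrix Z Z' ℂ :=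
  (Matrix.of fun z w => ψ (z, w)) * (Matrix.of fun z w => χ (z, w))ᴴ

/-- The real linear functional `V ↦ Re tr (V X)`. -/
def traceFunctional {m n : Type} [Fintype m] [Fintype n] (X : Matrix n m ℂ) :
    Matrix m n ℂ →ₗ[ℝ] ℝ where
  toFun V := (V * X).trace.re
  map_add' V V' := by simp [Matrix.add_mul]
  map_smul' r V := by simp

theorem trace_mul_crossTrace {Z Z' W : Type} [Fintype Z] [Fintype Z'] [Fintype W]
    (V : Matrix Z' Z ℂ) (ψ : Z × W → ℂ) (χ : Z' × W → ℂ) :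
    (V * crossTrace ψ χ).trace =
      star χ ⬝ᵥ fun p => ∑ z, V p.1 z * ψ (z, p.2) := by
  rw [crossTrace, ← Matrix.mul_assoc, Matrix.trace_mul_comm]
  simp only [Matrix.trace, Matrix.diag, Matrix.mul_apply, Matrix.conjTranspose_apply,
    Matrix.of_apply, dotProduct, Fintype.sum_prod_type_right]
  rfl

theorem committedState_dotProduct (a : Bool) (B : PureCoStrategy H.commit Unit) :
    star (committedState H a B) ⬝ᵥ committedState H a B = 1 := by
  rw [committedState, finalState_dotProduct]
  simp [dotProduct]

theorem acceptProb_nonneg (β : Bob H) (a b : Bool)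
    (C : PureStrategy (H.reveal b) (H.A a).Final) : 0 ≤ acceptProb β a b C :=
  outcomeProb_nonneg (β.isEffect b).1 _

theorem acceptProb_le_one (β : Bob H) (a b : Bool)
    (C : PureStrategy (H.reveal b) (H.A a).Final) : acceptProb β a b C ≤ 1 := by
  classical
  refine (outcomeProb_le (isEffect_iff.mp (β.isEffect b)).2 _).trans ?_
  rw [finalState_dotProduct, committedState_dotProduct, Complex.one_re]

/-- The two branches live on orthogonal memories of Bob, so tracing his memory out kills the
interference terms, and the amplitudes √p, √q become weights p, q. -/
theorem crossTrace_mix (a b : Bool) (T T' : PureCoStrategy H.commit Unit) {p q : ℝ} (hp : 0 ≤ p)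
    (hq : 0 ≤ q) (hpq : p + q = 1) :
    crossTrace (committedState H a (T.mix T' p q hp hq hpq))
        (committedState H b (T.mix T' p q hp hq hpq)) =
      (p : ℂ) • crossTrace (committedState H a T) (committedState H b T) +
        (q : ℂ) • crossTrace (committedState H a T') (committedState H b T') := by
  have hpp : (√p : ℂ) * √p = p := by rw [← Complex.ofReal_mul, Real.mul_self_sqrt hp]
  have hqq : (√q : ℂ) * √q = q := by rw [← Complex.ofReal_mul, Real.mul_self_sqrt hq]
  have hl : ∀ c z w, committedState H c (T.mix T' p q hp hq hpq) (z, Sum.inl w) =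
      √p * committedState H c T (z, w) := fun c z w =>
    (stateAfter_mix (H.A c) T T' hp hq hpq _ H.commit.rounds).1 default z w
  have hr : ∀ c z w, committedState H c (T.mix T' p q hp hq hpq) (z, Sum.inr w) =
      √q * committedState H c T' (z, w) := fun c z w =>
    (stateAfter_mix (H.A c) T T' hp hq hpq _ H.commit.rounds).2 default z w
  ext z z'
  simp only [crossTrace, Matrix.mul_apply, Matrix.add_apply, Matrix.smul_apply, Matrix.of_apply,
    Matrix.conjTranspose_apply, smul_eq_mul, ← hpp, ← hqq]
  refine (Fintype.sum_sum_type _).trans ?_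
  simp only [hl, hr, star_mul', Complex.star_def, Complex.conj_ofReal, Finset.mul_sum]
  congr 1 <;> exact Finset.sum_congr rfl fun _ _ => by ring

open scoped Matrix.Norms.L2Operator in
/-- A dishonest Bob either distinguishes the two committed states well, or there is a contraction
of Alice's memory that makes them overlap. -/
theorem exists_contraction_of_bobCheat (P : BitCommitment) [∀ c, DecidableEq (P.A c).Final]
    (a : Bool) (T : PureCoStrategy P.commit Unit) :
    ∃ V : Matrix (P.A !a).Final (P.A a).Final ℂ, ‖V‖ ≤ 1 ∧
      2 - 2 * P.bobCheat ≤ (V * crossTrace (committedState P.toHonestAlice a T)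
        (committedState P.toHonestAlice (!a) T)).trace.re := by
  let := Classical.decEq T.Final
  have hbdd : BddAbove {p : ℝ | ∃ (T : PureCoStrategy P.commit Unit) (E : Matrix T.Final T.Final ℂ),
      letI := Classical.decEq T.Final
      IsEffect E ∧
        p = 1 / 2 * outcomeProb E (committedState P.toHonestAlice false T) +
          1 / 2 * outcomeProb (1 - E) (committedState P.toHonestAlice true T)} := by
    refine ⟨1, ?_⟩
    rintro _ ⟨T, E, hE, rfl⟩
    let := Classical.decEq T.Final
    have h1 := outcomeProb_le hE.2 (committedState P.toHonestAlice false T)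
    have h2 := outcomeProb_nonneg hE.1 (committedState P.toHonestAlice true T)
    rw [outcomeProb_one_sub]
    rw [committedState_dotProduct, Complex.one_re] at *
    linarith
  have hbob : ∀ E : Matrix T.Final T.Final ℂ, E.PosSemidef → (1 - E).PosSemidef →
      outcomeProb E (committedState P.toHonestAlice a T) +
        outcomeProb (1 - E) (committedState P.toHonestAlice (!a) T) ≤ 2 * P.bobCheat := by
    intro E hE hE'
    cases a with
    | false =>
      have := le_csSup hbdd ⟨T, E, ⟨hE, hE'⟩, rfl⟩
      change _ ≤ P.bobCheat at this
      rw [Bool.not_false]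
      linarith
    | true =>
      -- In the definition E stands for the guess `false`, so for a = `true` the two outcomes are
      -- exchanged.
      have := le_csSup hbdd ⟨T, 1 - E, ⟨hE', by rwa [sub_sub_cancel]⟩, rfl⟩
      change _ ≤ P.bobCheat at this
      rw [sub_sub_cancel] at this
      rw [Bool.not_true]
      linarith
  have htr : ∀ c, ((Matrix.of fun z w => committedState P.toHonestAlice c T (z, w))ᴴ *
      Matrix.of fun z w => committedState P.toHonestAlice c T (z, w)).trace.re = 1 := by
    intro c
    have h1 := outcomeProb_one_sub 0 (committedState P.toHonestAlice c T)
    rw [outcomeProb_eq_trace, outcomeProb_eq_trace, committedState_dotProduct] at h1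
    simpa using h1
  obtain ⟨E, V, hE, hE', hV, h⟩ := exists_effect_contraction _ _ (htr a) (htr !a)
  refine ⟨V, hV, ?_⟩
  have h1 := hbob Eᵀ hE.transpose (by simpa using hE'.transpose)
  rw [outcomeProb_eq_trace, outcomeProb_eq_trace, Matrix.transpose_sub, Matrix.transpose_one,
    Matrix.transpose_transpose] at h1
  rw [crossTrace]
  linarith

open scoped Matrix.Norms.L2Operator in
/-- If a contraction of Alice's memory makes the two committed states overlap whatever Bob does in
the commit phase, then she can change her commitment. -/
theorem sq_le_aliceCheat (P : BitCommitment) (a : Bool) [DecidableEq (P.A a).Final]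
    {V : Matrix (P.A !a).Final (P.A a).Final ℂ} (hV : ‖V‖ ≤ 1) {c : ℝ} (hc : 0 ≤ c)
    (h : ∀ T : PureCoStrategy P.commit Unit, c ≤ (V * crossTrace
      (committedState P.toHonestAlice a T) (committedState P.toHonestAlice (!a) T)).trace.re) :
    c ^ 2 ≤ P.aliceCheat a := by
  classical
  obtain ⟨β₀, hβ₀⟩ := P.nonempty
  have : Nonempty P.bobs := ⟨⟨β₀, hβ₀⟩⟩
  have : Nonempty (P.A !a).Final := by
    by_contra hemp
    rw [not_nonempty_iff] at hemp
    have := committedState_dotProduct (H := P.toHonestAlice) (!a) β₀.B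
    simp [dotProduct] at this
  obtain ⟨J, hJ, hJV⟩ := exists_isometry_of_norm_le_one hV
  have hbdd : BddAbove (Set.range fun C : PureStrategy (P.reveal !a) (P.A a).Final =>
      ⨅ β : P.bobs, acceptProb β.1 a (!a) C) := by
    refine ⟨1, ?_⟩
    rintro _ ⟨C, rfl⟩
    refine (ciInf_le ⟨0, ?_⟩ ⟨β₀, hβ₀⟩).trans (acceptProb_le_one β₀ a (!a) C)
    rintro _ ⟨β, rfl⟩
    exact acceptProb_nonneg _ _ _ _
  -- Alice's attack: apply the dilation J of V, then reveal the other bit honestly, leaving the flag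
  -- idle.
  refine le_trans ?_ (le_ciSup hbdd ((P.R !a).afterIsometry (Option (P.A a).Final) J hJ))
  refine le_ciInf fun β => ?_
  obtain ⟨β, hβ⟩ := β
  set D := β.D !a
  set ψ := committedState P.toHonestAlice a β.B with hψ
  set χ := committedState P.toHonestAlice (!a) β.B with hχ
  set ψV : (P.A !a).Final × β.B.Final → ℂ := fun p => ∑ z, V p.1 z * ψ (z, p.2) with hψV
  have hE := isEffect_iff.mp (β.isEffect !a)
  have hov : c ≤ (star χ ⬝ᵥ ψV).re := by
    rw [hψV, ← trace_mul_crossTrace]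
    exact h β.B
  have hχ1 : (star (finalState (P.R !a) D χ) ⬝ᵥ finalState (P.R !a) D χ).re = 1 := by
    rw [finalState_dotProduct, hχ, committedState_dotProduct, Complex.one_re]
  have h1 := sq_le_outcomeProb hE.1 hE.2 hχ1 (P.complete β hβ !a) (finalState (P.R !a) D ψV)
  rw [finalState_dotProduct] at h1
  have h2 : c ^ 2 ≤ ‖star χ ⬝ᵥ ψV‖ ^ 2 := by
    have := hov.trans ((le_abs_self _).trans (Complex.abs_re_le_norm _))
    gcongr
  refine h2.trans (h1.trans ?_)
  rw [acceptProb, outcomeProb_eq_sum, outcomeProb_eq_sum]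
  refine le_trans ?_ (le_of_eq (Fintype.sum_prod_type_right _).symm)
  -- Only the branch with flag `none`, where V has been applied, is kept; the others contribute
  -- nonnegatively.
  rw [Fintype.sum_option]
  refine le_trans (le_of_eq ?_) (le_add_of_nonneg_right
    (Finset.sum_nonneg fun g _ => Finset.sum_nonneg fun z _ => hE.1.re_dotProduct_nonneg _))
  refine Finset.sum_congr rfl fun z _ => ?_
  have hfin : ∀ w, finalState ((P.R !a).afterIsometry (Option (P.A a).Final) J hJ) D ψ
      ((z, none), w) = finalState (P.R !a) D ψV (z, w) := by
    intro w
    refine (stateAfter_afterIsometry _ _ _ _ _ _ _ _ _ _).trans ?_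
    simp only [hJV]
    rfl
  simp_rw [← hfin]
  rfl

open scoped Matrix.Norms.L2Operator in
theorem two_le_sqrt_aliceCheat_add (P : BitCommitment) (a : Bool) :
    2 ≤ √(P.aliceCheat a) + 2 * P.bobCheat := by
  classical
  -- Squaring c = 2 - 2 B_BC requires c ≥ 0; otherwise the bound is trivial.
  rcases le_total (2 - 2 * P.bobCheat) 0 with hc | hc
  · linarith [Real.sqrt_nonneg (P.aliceCheat a)]
  let f : PureCoStrategy P.commit Unit → Matrix (P.A !a).Final (P.A a).Final ℂ →ₗ[ℝ] ℝ := fun T =>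
    traceFunctional (crossTrace (committedState P.toHonestAlice a T)
      (committedState P.toHonestAlice (!a) T))
  have hK : Convex ℝ (Set.range f) := by
    rintro _ ⟨T, rfl⟩ _ ⟨T', rfl⟩ p q hp hq hpq
    refine ⟨T.mix T' p q hp hq hpq, ?_⟩
    ext V
    simp [f, traceFunctional, crossTrace_mix, Matrix.mul_add]
  obtain ⟨β₀, -⟩ := P.nonempty
  obtain ⟨V, hV, h⟩ := exists_forall_le_of_forall_exists_le
    (isCompact_closedBall (0 : Matrix (P.A !a).Final (P.A a).Final ℂ) 1) (convex_closedBall _ _)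
    hK ⟨_, β₀.B, rfl⟩ (c := 2 - 2 * P.bobCheat) (by
      rintro _ ⟨T, rfl⟩
      obtain ⟨V, hV, h⟩ := exists_contraction_of_bobCheat P a T
      exact ⟨V, mem_closedBall_zero_iff.mpr hV, h⟩)
  have := sq_le_aliceCheat P a (mem_closedBall_zero_iff.mp hV) hc fun T => h _ ⟨T, rfl⟩
  linarith [Real.le_sqrt_of_sq_le this]

end Protocol

end QBC

end

theorem mainTheorem6 (P : QBC.BitCommitment) (a : Bool) :
    2 ≤ Real.sqrt (P.aliceCheat a) + 2 * P.bobCheat ∧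
      (9 - Real.sqrt 17) / 8 ≤ max (P.aliceCheat a) P.bobCheat := by
  have h := QBC.two_le_sqrt_aliceCheat_add P a
  refine ⟨h, ?_⟩
  by_contra! hlt
  have h17 : √17 * √17 = 17 := Real.mul_self_sqrt (by norm_num)
  have h4 : 4 < √17 := Real.lt_sqrt_of_sq_lt (by norm_num)
  -- ((√17 - 1)/4)² = (9 - √17)/8, and m = (9 - √17)/8 solves √m + 2m = 2.
  have hs : √(P.aliceCheat a) < (√17 - 1) / 4 := by
    rw [Real.sqrt_lt' (by linarith)]
    linarith [le_max_left (P.aliceCheat a) P.bobCheat]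
  linarith [le_max_right (P.aliceCheat a) P.bobCheat]
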